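/- \textbf{Setting.} A (generalized) nonlocality proof consists of a number $k$ of parties, for each party $j$ a finite set of measurement settings, for each setting $s$ of party $j$ a finite set $X_{j,s}$ of outcomes, and, for every joint setting $a=(a_1,\dots,a_k)$, a probability distribution $Q_a$ on the joint outcomes $x\in\prod_j X_{j,a_j}$. (The $2\times2\times2$ proofs are those with two parties, two settings per party and two outcomes per setting.) Let $\Pi$ be the simplex of local theories, that is, of all probability vectors $\pi=(\pi_h)$ indexed by the families $h=(h_{j,s})$ with $h_{j,s}\in X_{j,s}$ for all $j$ and all settings $s$ of $j$, and put $$P_{a;\pi}(x)=\sum_{h:\ h_{j,a_j}=x_j\ \forall j}\pi_h .$$ Fix a probability distribution $\sigma$ on the joint settings. One trial yields a pair $z=(a,x)$ of a joint setting and a joint outcome; set $Q_\sigma(a,x)=\sigma_aQ_a(x)$ and $P_{\sigma;\pi}(a,x)=\sigma_aP_{a;\pi}(x)$. Logarithms are to base $2$, and $D(Q\|P)=\sum_z Q(z)\log\frac{Q(z)}{P(z)}\in[0,\infty]$, with the conventions that terms with $Q(z)=0$ are $0$ and terms with $Q(z)>0=P(z)$ are $\infty$. Test $H_1=\{Q_\sigma\}$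 against $H_0=\{P_{\sigma;\pi}:\pi\in\Pi\}$ with prior probabilities $\Pr(H_1)=p\in(0,1)$ and $\Pr(H_0)=1-p$. Conditionally on $H_0$, let $\pi$ have a prior probability density $w$ with respect to Lebesgue measure $d\pi$ on the simplex $\Pi$, where $w$ is continuous on $\Pi$ and $w(\pi)>w_{\min}$ for all $\pi\in\Pi$, for some constant $w_{\min}>0$. With $$\Pr(z_1,\dots,z_n\mid H_1)=\prod_{i=1}^nQ_\sigma(z_i),\qquad \Pr(z_1,\dots,z_n\mid H_0)=\int_\Pi\prod_{i=1}^nP_{\sigma;\pi}(z_i)\,w(\pi)\,d\pi,$$ let $\Pr(H_i\mid z_1,\dots,z_n)$ be the posterior probabilities given by Bayes' rule, and let $$\mathrm{postodds}(z_1,\dots,z_n)=\frac{\Pr(H_1\mid z_1,\dots,z_n)}{\Pr(H_0\mid z_1,\dots,z_n)} .$$ \textbf{Theorem.} If $Z_1,Z_2,\dots$ are independent random variables, each with distribution $Q_\sigma$, then with probability one $$\lim_{n\to\infty}\frac1n\log \mathrm{postodds}(Z_1,\dots,Z_n)=\inf_{\pi\in\Pi}D(Q_\sigma\|P_{\sigma;\pi}).$$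 -/

import Mathlib

open MeasureTheory ProbabilityTheory Filter Topology

noncomputable section

/-- A (generalized) nonlocality proof: `k` parties, party `j` having `numSettings j` measurement
settings, setting `s` of party `j` having `numOutcomes j s` outcomes, together with one probability
distribution `Q a` on joint outcomes for every joint setting `a`. The `2 × 2 × 2` proofs are the
case in which `k`, all `numSettings j` and all `numOutcomes j s` are equal to `2`. -/
structure NonlocalityProof where
  /-- the number of parties -/
  k : ℕ
  /-- the number of measurement settings of each party -/
  numSettings : Fin k → ℕ
  /-- the number of outcomes of each setting of each party -/
  numOutcomes : (j : Fin k) → Fin (numSettings j) → ℕ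
  /-- the probabilities of the joint outcomes, for each joint setting -/
  Q : (a : (j : Fin k) → Fin (numSettings j)) →
    ((j : Fin k) → Fin (numOutcomes j (a j))) → ℝ
  /-- each `Q a` is a probability distribution -/
  Q_mem : ∀ a : (j : Fin k) → Fin (numSettings j),
    Q a ∈ stdSimplex ℝ ((j : Fin k) → Fin (numOutcomes j (a j)))

namespace NonlocalityProof

/-- Joint measurement settings. -/
abbrev Setting (N : NonlocalityProof) : Type :=
  (j : Fin N.k) → Fin (N.numSettings j)

/-- Joint outcomes under the joint setting `a`. -/
abbrev Outcome (N : NonlocalityProof) (a : N.Setting) : Type :=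
  (j : Fin N.k) → Fin (N.numOutcomes j (a j))

/-- A simultaneous assignment of an outcome to every setting of every party: the values of all
the variables "outcome that party `j` would have observed under setting `s`". -/
abbrev Assignment (N : NonlocalityProof) : Type :=
  (j : Fin N.k) → (s : Fin (N.numSettings j)) → Fin (N.numOutcomes j s)

/-- The set of setting distributions. -/
abbrev settingSimplex (N : NonlocalityProof) : Set (N.Setting → ℝ) :=
  stdSimplex ℝ N.Setting

/-- The set of local (realist) theories: all probability vectors on assignments. -/
abbrev localTheories (N : NonlocalityProof) : Set (N.Assignment → ℝ) :=
  stdSimplex ℝ N.Assignment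

/-- The result of one trial: a joint setting and a joint outcome in that setting. -/
def Trial (N : NonlocalityProof) : Type := (a : N.Setting) × N.Outcome a

instance (N : NonlocalityProof) : Fintype N.Trial :=
  inferInstanceAs (Fintype ((a : N.Setting) × N.Outcome a))

/-- Every set of trial results is an event. -/
instance (N : NonlocalityProof) : MeasurableSpace N.Trial := ⊤

instance (N : NonlocalityProof) : DiscreteMeasurableSpace N.Trial := ⟨fun _ => trivial⟩

/-- The quantum distribution `Q_σ` of a single trial. -/
def quantumDist (N : NonlocalityProof) (σ : N.Setting → ℝ) (z : N.Trial) : ℝ :=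
  σ z.1 * N.Q z.1 z.2

/-- The distribution `P_{a;π}` of the joint outcome under setting `a`, according to `π`. -/
def localCond (N : NonlocalityProof) (π : N.Assignment → ℝ) (a : N.Setting) (x : N.Outcome a) :
    ℝ :=
  ∑ h : N.Assignment, if ∀ j, h j (a j) = x j then π h else 0

/-- The distribution `P_{σ;π}` of a single trial according to the local theory `π`. -/
def localDist (N : NonlocalityProof) (σ : N.Setting → ℝ) (π : N.Assignment → ℝ) (z : N.Trial) :
    ℝ :=
  σ z.1 * N.localCond π z.1 z.2

end NonlocalityProof

/-- Kullback-Leibler divergence `D(Q‖P)`, to base `2`, of distributions on a finite set, with the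
conventions `0 log (0 / p) = 0` for all `p ≥ 0` and `q log (q / 0) = ∞` for `q > 0`. -/
def klDivTwo {α : Type*} [Fintype α] (Q P : α → ℝ) : EReal :=
  ∑ z, if Q z = 0 then 0 else if P z = 0 then ⊤ else ((Q z * Real.logb 2 (Q z / P z) : ℝ) : EReal)

/-- Lebesgue (surface) measure on the probability simplex in `ℝ^ι`: the Euclidean Hausdorff measure
of dimension `card ι - 1`, restricted to the simplex. -/
def simplexVolume (ι : Type*) [Fintype ι] : Measure (ι → ℝ) :=
  ((Measure.euclideanHausdorffMeasure (Fintype.card ι - 1) :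
    Measure (EuclideanSpace ℝ ι)).map WithLp.ofLp).restrict (stdSimplex ℝ ι)

/-- `w` is a probability density on the simplex that is continuous and bounded away from `0`. -/
structure IsRegularPriorDensity {ι : Type*} [Fintype ι] (w : (ι → ℝ) → ℝ) : Prop where
  continuousOn : ContinuousOn w (stdSimplex ℝ ι)
  bounded_away : ∃ wmin : ℝ, 0 < wmin ∧ ∀ π ∈ stdSimplex ℝ ι, wmin < w π
  integral_eq_one : ∫ π, w π ∂(simplexVolume ι) = 1

namespace NonlocalityProof

variable (N : NonlocalityProof) (σ : N.Setting → ℝ) (w : (N.Assignment → ℝ) → ℝ) (p : ℝ) {n : ℕ}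
  (z : Fin n → N.Trial)

/-- `Pr(z₁, …, zₙ | H₁) = Q_σ(z₁, …, zₙ)`. -/
def marginalQuantum : ℝ := ∏ i, N.quantumDist σ (z i)

/-- `Pr(z₁, …, zₙ | H₀) = ∫ P_{σ;π}(z₁, …, zₙ) w(π) dπ`. -/
def marginalLocal : ℝ :=
  ∫ π, (∏ i, N.localDist σ π (z i)) * w π ∂(simplexVolume N.Assignment)

/-- `Pr(H₁ | z₁, …, zₙ)` by Bayes' rule, with prior probabilities `Pr(H₁) = p`,
`Pr(H₀) = 1 - p`. -/
def posteriorQuantum : ℝ :=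
  N.marginalQuantum σ z * p / (N.marginalQuantum σ z * p + N.marginalLocal σ w z * (1 - p))

/-- `Pr(H₀ | z₁, …, zₙ)` by Bayes' rule, with prior probabilities `Pr(H₁) = p`,
`Pr(H₀) = 1 - p`. -/
def posteriorLocal : ℝ :=
  N.marginalLocal σ w z * (1 - p) / (N.marginalQuantum σ z * p + N.marginalLocal σ w z * (1 - p))

/-- The posterior odds of `H₁ = {Q_σ}` against `H₀ = {P_{σ;π} : π}`. -/
def postOdds : ℝ := N.posteriorQuantum σ w p z / N.posteriorLocal σ w p z

end NonlocalityProof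

end

/-!
Write `q` for the quantum distribution of a trial, `P_π` for the local one, `S = ∑ q log q`, and
`D` for the infimum of the divergences. By the strong law of large numbers, almost surely the
empirical frequencies `f_n` of the trial results converge to `q`, and all results lie in the support
of `q`. On such a sequence the normalized logarithm of the quantum likelihood tends to `S`, and the
likelihood of `π` is `2 ^ (n * ∑ f_n log P_π)` unless it vanishes. It remains to show that the marginal
likelihood of local realism grows like `2 ^ (n * (S - D))`.

* Upper bound (`prod_range_le_rpow`, `eventually_logb_marginalLocal_le`). For every `t < 1`,
  eventually `f_n ≥ t * q`. As `log P_π ≤ 0`, this gives `∑ f_n log P_π ≤ t * ∑ q log P_π ≤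
  t * (S - D)` for all `π` at once, so no compactness argument is needed, and the average over the
  prior satisfies the same bound.
* Lower bound (`simplexVolume_simplexAbove_pos`, `exists_mul_prod_le_marginalLocal`). Let `π₀` be
  nearly optimal and `c < 1` close to `1`. On the set of `π ≥ c * π₀` one has `P_π ≥ c * P_π₀`. This
  set contains a homothetic copy of the whole simplex, hence has positive volume, which is a
  constant factor that disappears in the limit; the prior density is bounded below there.

The infimum is finite because the uniform local theory is positive on the support of `q`.
-/

/-! ### Empirical frequencies -/

/-- The fraction of the first `n` terms of the sequence `z` that are equal to `a`
(equal to `0` for `n = 0`). -/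
noncomputable def empiricalFreq {α : Type*} (z : ℕ → α) (n : ℕ) (a : α) : ℝ :=
  (∑ i ∈ Finset.range n, Set.indicator {a} (1 : α → ℝ) (z i)) / n

theorem empiricalFreq_nonneg {α : Type*} (z : ℕ → α) (n : ℕ) (a : α) :
    0 ≤ empiricalFreq z n a :=
  div_nonneg (Finset.sum_nonneg fun i _ => Set.indicator_nonneg (by simp) _) n.cast_nonneg

theorem exists_eq_of_empiricalFreq_pos {α : Type*} {z : ℕ → α} {n : ℕ} {a : α}
    (h : 0 < empiricalFreq z n a) : ∃ i < n, z i = a := by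
  by_contra! hne
  refine h.ne' ?_
  rw [empiricalFreq, Finset.sum_eq_zero, zero_div]
  intro i hi
  simp [hne i (Finset.mem_range.1 hi)]

theorem sum_range_eq_mul_sum_empiricalFreq {α : Type*} [Fintype α] (z : ℕ → α) (n : ℕ)
    (g : α → ℝ) :
    ∑ i ∈ Finset.range n, g (z i) = n * ∑ a, empiricalFreq z n a * g a := by
  classical
  rcases Nat.eq_zero_or_pos n with rfl | hn
  · simp
  have hn' : (n : ℝ) ≠ 0 := by positivity
  simp only [empiricalFreq, Finset.mul_sum, Finset.sum_mul, div_mul_eq_mul_div,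
    mul_div_cancel₀ _ hn']
  rw [Finset.sum_comm]
  refine Finset.sum_congr rfl fun i _ => ?_
  simp [Set.indicator_apply]

theorem logb_prod_range_eq_mul_sum_empiricalFreq {α : Type*} [Fintype α] {z : ℕ → α} {n : ℕ}
    {g : α → ℝ} (hg : ∀ i < n, g (z i) ≠ 0) :
    Real.logb 2 (∏ i ∈ Finset.range n, g (z i)) =
      n * ∑ a, empiricalFreq z n a * Real.logb 2 (g a) := by
  rw [Real.logb_prod _ _ fun i hi => hg i (Finset.mem_range.1 hi)]
  exact sum_range_eq_mul_sum_empiricalFreq z n fun a => Real.logb 2 (g a)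

/-- The strong law of large numbers for the frequency of each value. -/
theorem ae_tendsto_empiricalFreq {Ω α : Type*} [MeasurableSpace Ω] [Fintype α]
    [MeasurableSpace α] [DiscreteMeasurableSpace α] {μ : Measure Ω} [IsProbabilityMeasure μ]
    {Z : ℕ → Ω → α} {q : α → ℝ} (hZ : ∀ i, Measurable (Z i)) (hindep : iIndepFun Z μ)
    (hlaw : ∀ i a, μ.real (Z i ⁻¹' {a}) = q a) :
    ∀ᵐ ω ∂μ, ∀ a, Tendsto (fun n => empiricalFreq (fun i => Z i ω) n a) atTop (𝓝 (q a)) := by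
  rw [ae_all_iff]
  intro a
  have hm : Measurable (Set.indicator {a} (1 : α → ℝ)) := .of_discrete
  have hmap : ∀ i, μ.map (Z i) = μ.map (Z 0) := fun i => by
    refine Measure.ext_of_singleton fun b => ?_
    rw [Measure.map_apply (hZ i) .of_discrete, Measure.map_apply (hZ 0) .of_discrete,
      ← measureReal_eq_measureReal_iff, hlaw, hlaw]
  have hcomp : ∀ i, (fun ω => Set.indicator {a} (1 : α → ℝ) (Z i ω)) =
      Set.indicator (Z i ⁻¹' {a}) 1 := fun i => by
    ext ω
    by_cases h : Z i ω = a <;> simp [h]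
  have h := strong_law_ae_real (μ := μ) (fun i ω => Set.indicator {a} (1 : α → ℝ) (Z i ω))
    (by
      rw [hcomp]
      exact (integrable_const (1 : ℝ)).indicator (hZ 0 .of_discrete))
    (fun i j hij => (hindep.indepFun hij).comp hm hm)
    (fun i => IdentDistrib.comp ⟨(hZ i).aemeasurable, (hZ 0).aemeasurable, hmap i⟩ hm)
  have hint : μ[fun ω => Set.indicator {a} (1 : α → ℝ) (Z 0 ω)] = q a := by
    rw [hcomp, integral_indicator_one (hZ 0 .of_discrete), hlaw]
  rw [hint] at h
  exact h

theorem ae_forall_law_ne_zero {Ω α : Type*} [MeasurableSpace Ω] [Fintype α]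
    {μ : Measure Ω} [IsProbabilityMeasure μ] {Z : ℕ → Ω → α} {q : α → ℝ}
    (hlaw : ∀ i a, μ.real (Z i ⁻¹' {a}) = q a) :
    ∀ᵐ ω ∂μ, ∀ i, q (Z i ω) ≠ 0 := by
  rw [ae_all_iff]
  intro i
  have h : ∀ᵐ ω ∂μ, ∀ a, q a = 0 → Z i ω ≠ a := by
    rw [ae_all_iff]
    intro a
    by_cases ha : q a = 0
    · have h0 : μ (Z i ⁻¹' {a}) = 0 := by
        rwa [← measureReal_eq_zero_iff, hlaw]
      filter_upwards [measure_eq_zero_iff_ae_notMem.1 h0] with ω hω _ using hω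
    · simp [ha]
  filter_upwards [h] with ω hω h0 using hω _ h0 rfl

/-- Likelihood bound that is uniform in `P`: a lower bound `t * q` on the empirical frequencies is
enough because every `logb 2 (P a)` is nonpositive. -/
theorem prod_range_le_rpow {α : Type*} [Fintype α] {z : ℕ → α} {n : ℕ} {q P : α → ℝ} {t L : ℝ}
    (ht : 0 < t) (hq : ∀ a, 0 ≤ q a) (hfreq : ∀ a, t * q a ≤ empiricalFreq z n a)
    (hP0 : ∀ a, 0 ≤ P a) (hP1 : ∀ a, P a ≤ 1)
    (hL : (∀ a, q a ≠ 0 → P a ≠ 0) → ∑ a, q a * Real.logb 2 (P a) ≤ L) :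
    ∏ i ∈ Finset.range n, P (z i) ≤ (2 : ℝ) ^ (n * (t * L)) := by
  by_cases hz : ∀ i < n, P (z i) ≠ 0
  · have hpos : 0 < ∏ i ∈ Finset.range n, P (z i) :=
      Finset.prod_pos fun i hi => (hP0 _).lt_of_ne' (hz i (Finset.mem_range.1 hi))
    rw [← Real.logb_le_iff_le_rpow one_lt_two hpos, logb_prod_range_eq_mul_sum_empiricalFreq hz]
    have hsupp : ∀ a, q a ≠ 0 → P a ≠ 0 := fun a ha => by
      obtain ⟨i, hi, rfl⟩ := exists_eq_of_empiricalFreq_pos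
        ((mul_pos ht ((hq a).lt_of_ne' ha)).trans_le (hfreq a))
      exact hz i hi
    refine mul_le_mul_of_nonneg_left ?_ n.cast_nonneg
    refine le_trans ?_ (mul_le_mul_of_nonneg_left (hL hsupp) ht.le)
    rw [Finset.mul_sum]
    refine Finset.sum_le_sum fun a _ => ?_
    rw [← mul_assoc]
    exact mul_le_mul_of_nonpos_right (hfreq a)
      (Real.logb_nonpos one_lt_two (hP0 a) (hP1 a))
  · push Not at hz
    obtain ⟨i, hi, h0⟩ := hz
    rw [Finset.prod_eq_zero (Finset.mem_range.2 hi) h0]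
    positivity

/-! ### The divergence as an extended real number -/

theorem klDivTwo_eq_coe {α : Type*} [Fintype α] {Q P : α → ℝ} (h : ∀ a, Q a ≠ 0 → P a ≠ 0) :
    klDivTwo Q P =
      ((∑ a, Q a * Real.logb 2 (Q a) - ∑ a, Q a * Real.logb 2 (P a) : ℝ) : EReal) := by
  have hcoe : ∀ f : α → ℝ, ((∑ a, f a : ℝ) : EReal) = ∑ a, (f a : EReal) := fun f =>
    map_sum (⟨⟨((↑) : ℝ → EReal), rfl⟩, EReal.coe_add⟩ : ℝ →+ EReal) f _
  rw [← Finset.sum_sub_distrib, hcoe, klDivTwo]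
  refine Finset.sum_congr rfl fun a _ => ?_
  by_cases hQ : Q a = 0
  · simp [hQ]
  · rw [if_neg hQ, if_neg (h a hQ), Real.logb_div hQ (h a hQ), mul_sub]

theorem klDivTwo_eq_top {α : Type*} [Fintype α] {Q P : α → ℝ} {a : α} (hQ : Q a ≠ 0)
    (hP : P a = 0) : klDivTwo Q P = ⊤ := by
  classical
  rw [klDivTwo, ← Finset.add_sum_erase _ _ (Finset.mem_univ a), if_neg hQ, if_pos hP]
  refine EReal.top_add_of_ne_bot (Finset.sum_induction _ (· ≠ ⊥) ?_ (by simp) ?_)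
  · intro x y hx hy
    simp [EReal.add_eq_bot_iff, hx, hy]
  · intro b _
    split_ifs
    · simp
    · simp
    · exact EReal.coe_ne_bot _

/-! ### Prior densities and volume on the simplex -/

theorem ae_mem_stdSimplex (ι : Type*) [Fintype ι] :
    ∀ᵐ π ∂simplexVolume ι, π ∈ stdSimplex ℝ ι :=
  ae_restrict_mem (isClosed_stdSimplex ℝ ι).measurableSet

namespace IsRegularPriorDensity

variable {ι : Type*} [Fintype ι] {w : (ι → ℝ) → ℝ}

/-- A non-integrable function would have integral `0`, not `1`. -/
theorem integrable (hw : IsRegularPriorDensity w) : Integrable w (simplexVolume ι) := by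
  by_contra h
  simpa [integral_undef h] using hw.integral_eq_one

/-- The simplex has finite volume because a prior density is integrable and bounded away from
`0`. -/
theorem isFiniteMeasure (hw : IsRegularPriorDensity w) : IsFiniteMeasure (simplexVolume ι) := by
  obtain ⟨c, hc, hcw⟩ := hw.bounded_away
  have h : Integrable (fun _ : ι → ℝ => c) (simplexVolume ι) := by
    refine hw.integrable.mono' aestronglyMeasurable_const ?_
    filter_upwards [ae_mem_stdSimplex ι] with π hπ
    rw [Real.norm_of_nonneg hc.le]
    exact (hcw π hπ).le
  exact (integrable_const_iff.1 h).resolve_left hc.ne'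

theorem simplexVolume_ne_zero (hw : IsRegularPriorDensity w) : simplexVolume ι ≠ 0 := by
  intro h
  simpa [h] using hw.integral_eq_one

end IsRegularPriorDensity

/-- The set of `π` in the simplex with `c * π₀ ≤ π` coordinatewise. -/
def simplexAbove {ι : Type*} [Fintype ι] (c : ℝ) (π₀ : ι → ℝ) : Set (ι → ℝ) :=
  {π ∈ stdSimplex ℝ ι | ∀ i, c * π₀ i ≤ π i}

theorem measurableSet_simplexAbove {ι : Type*} [Fintype ι] (c : ℝ) (π₀ : ι → ℝ) :
    MeasurableSet (simplexAbove c π₀) := by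
  have h : simplexAbove c π₀ = stdSimplex ℝ ι ∩ ⋂ i, {π | c * π₀ i ≤ π i} := by
    ext π
    simp [simplexAbove]
  rw [h]
  refine ((isClosed_stdSimplex ℝ ι).inter ?_).measurableSet
  exact isClosed_iInter fun i => isClosed_le continuous_const (continuous_apply i)

/-- `simplexAbove c π₀` contains the image of the simplex under the homothety with centre `π₀` and
ratio `1 - c`, which multiplies the volume by a positive factor. -/
theorem simplexVolume_simplexAbove_pos {ι : Type*} [Fintype ι] (hvol : simplexVolume ι ≠ 0)
    {c : ℝ} (hc0 : 0 ≤ c) (hc1 : c < 1) {π₀ : ι → ℝ} (hπ₀ : π₀ ∈ stdSimplex ℝ ι) :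
    0 < simplexVolume ι (simplexAbove c π₀) := by
  have hm : Measurable (WithLp.ofLp : EuclideanSpace ℝ ι → ι → ℝ) := by fun_prop
  have hne : (1 - c) ≠ 0 := by linarith
  have hS : (Measure.euclideanHausdorffMeasure (Fintype.card ι - 1) :
      Measure (EuclideanSpace ℝ ι)) (WithLp.ofLp ⁻¹' stdSimplex ℝ ι) ≠ 0 := by
    rw [← Measure.map_apply hm (isClosed_stdSimplex ℝ ι).measurableSet]
    simpa [simplexVolume, Measure.restrict_eq_zero] using hvol
  rw [simplexVolume, Measure.restrict_apply (measurableSet_simplexAbove c π₀),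
    Set.inter_eq_left.2 fun π hπ => hπ.1, Measure.map_apply hm (measurableSet_simplexAbove c π₀)]
  refine lt_of_lt_of_le ?_ (measure_mono (s := AffineMap.homothety (WithLp.toLp 2 π₀) (1 - c) ''
    (WithLp.ofLp ⁻¹' stdSimplex ℝ ι)) ?_)
  · rw [euclideanHausdorffMeasure_homothety_image _ _ hne]
    refine pos_iff_ne_zero.2 ?_
    simp [ENNReal.smul_def, hne, hS]
  · rintro _ ⟨x, hx, rfl⟩
    have hval : ∀ i, (AffineMap.homothety (WithLp.toLp 2 π₀) (1 - c) x).ofLp i =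
        c * π₀ i + (1 - c) * x.ofLp i := fun i => by
      simp [AffineMap.homothety_apply]; ring
    have hx0 : ∀ i, 0 ≤ (1 - c) * x.ofLp i := fun i =>
      mul_nonneg (by linarith) (hx.1 i)
    refine ⟨⟨fun i => ?_, ?_⟩, fun i => ?_⟩
    · rw [hval]
      exact add_nonneg (mul_nonneg hc0 (hπ₀.1 i)) (hx0 i)
    · simp only [hval, Finset.sum_add_distrib, ← Finset.mul_sum]
      rw [hπ₀.2, show ∑ i, x.ofLp i = 1 from hx.2]
      ring
    · rw [hval]
      linarith [hx0 i]

/-! ### Distributions of a single trial -/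

namespace NonlocalityProof

variable {N : NonlocalityProof} {σ : N.Setting → ℝ}

theorem quantumDist_nonneg (hσ : σ ∈ N.settingSimplex) (z : N.Trial) :
    0 ≤ N.quantumDist σ z :=
  mul_nonneg (hσ.1 _) ((N.Q_mem _).1 _)

theorem localCond_nonneg {π : N.Assignment → ℝ} (hπ : π ∈ N.localTheories) (a : N.Setting)
    (x : N.Outcome a) : 0 ≤ N.localCond π a x :=
  Finset.sum_nonneg fun h _ => by split_ifs; exacts [hπ.1 h, le_rfl]

theorem localDist_nonneg (hσ : σ ∈ N.settingSimplex) {π : N.Assignment → ℝ}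
    (hπ : π ∈ N.localTheories) (z : N.Trial) : 0 ≤ N.localDist σ π z :=
  mul_nonneg (hσ.1 _) (localCond_nonneg hπ _ _)

theorem localDist_le_one (hσ : σ ∈ N.settingSimplex) {π : N.Assignment → ℝ}
    (hπ : π ∈ N.localTheories) (z : N.Trial) : N.localDist σ π z ≤ 1 := by
  refine mul_le_one₀ ?_ (localCond_nonneg hπ _ _) ?_
  · exact (Finset.single_le_sum (fun i _ => hσ.1 i) (Finset.mem_univ z.1)).trans_eq hσ.2
  · refine (Finset.sum_le_sum fun h _ => ?_).trans_eq hπ.2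
    split_ifs
    exacts [le_rfl, hπ.1 h]

theorem continuous_localDist (z : N.Trial) : Continuous fun π => N.localDist σ π z := by
  unfold localDist localCond
  refine continuous_const.mul (continuous_finsetSum _ fun h _ => ?_)
  split_ifs
  exacts [continuous_apply h, continuous_const]

theorem mul_localDist_le (hσ : σ ∈ N.settingSimplex) {c : ℝ} {π₀ π : N.Assignment → ℝ}
    (h : ∀ i, c * π₀ i ≤ π i) (z : N.Trial) : c * N.localDist σ π₀ z ≤ N.localDist σ π z := by
  rw [localDist, localDist, mul_left_comm]
  refine mul_le_mul_of_nonneg_left ?_ (hσ.1 _)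
  rw [localCond, localCond, Finset.mul_sum]
  refine Finset.sum_le_sum fun i _ => ?_
  split_ifs
  exacts [h i, (mul_zero c).le]

/-- Since distributions exist in every joint setting and there is a joint setting, no setting has
an empty set of outcomes. -/
theorem nonempty_assignment (hσ : σ ∈ N.settingSimplex) : Nonempty N.Assignment := by
  classical
  have hne : Nonempty N.Setting := by
    by_contra h
    rw [not_nonempty_iff] at h
    simpa using hσ.2
  obtain ⟨a⟩ := hne
  refine ⟨fun j s => Classical.choice ?_⟩
  have hx : Nonempty (N.Outcome (Function.update a j s)) := by
    by_contra h
    rw [not_nonempty_iff] at h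
    simpa using (N.Q_mem (Function.update a j s)).2
  obtain ⟨x⟩ := hx
  have := x j
  rw [Function.update_self] at this
  exact ⟨this⟩

/-- The uniform local theory gives every outcome of every setting positive probability. -/
theorem exists_localCond_pos (hσ : σ ∈ N.settingSimplex) :
    ∃ π ∈ N.localTheories, ∀ a x, 0 < N.localCond π a x := by
  classical
  obtain ⟨h₀⟩ := nonempty_assignment hσ
  have hcard : (0 : ℝ) < Fintype.card N.Assignment := by
    exact_mod_cast Fintype.card_pos_iff.2 ⟨h₀⟩
  refine ⟨fun _ => (Fintype.card N.Assignment : ℝ)⁻¹, ⟨fun _ => by positivity, ?_⟩, fun a x => ?_⟩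
  · rw [Finset.sum_const, Finset.card_univ, nsmul_eq_mul, mul_inv_cancel₀ hcard.ne']
  · refine Finset.sum_pos' (fun h _ => ?_)
      ⟨fun j => Function.update (h₀ j) (a j) (x j), Finset.mem_univ _, ?_⟩
    · split_ifs <;> positivity
    · rw [if_pos fun j => by simp]
      positivity

/-! ### Bounds on the marginal likelihood of local realism -/

variable {w : (N.Assignment → ℝ) → ℝ} {n : ℕ} (z : Fin n → N.Trial)

theorem integrable_likelihood_mul (hσ : σ ∈ N.settingSimplex) (hw : IsRegularPriorDensity w) :
    Integrable (fun π => (∏ i, N.localDist σ π (z i)) * w π) (simplexVolume N.Assignment) := by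
  refine hw.integrable.bdd_mul (c := 1)
    (continuous_finsetProd _ fun i _ => continuous_localDist (z i)).aestronglyMeasurable ?_
  filter_upwards [ae_mem_stdSimplex N.Assignment] with π hπ
  rw [Real.norm_of_nonneg (Finset.prod_nonneg fun i _ => localDist_nonneg hσ hπ _)]
  exact Finset.prod_le_one (fun i _ => localDist_nonneg hσ hπ _)
    fun i _ => localDist_le_one hσ hπ _

theorem marginalLocal_le (hσ : σ ∈ N.settingSimplex) (hw : IsRegularPriorDensity w) {C : ℝ}
    (hC : ∀ π ∈ N.localTheories, ∏ i, N.localDist σ π (z i) ≤ C) :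
    N.marginalLocal σ w z ≤ C := by
  obtain ⟨c, hc, hcw⟩ := hw.bounded_away
  calc N.marginalLocal σ w z ≤ ∫ π, C * w π ∂(simplexVolume N.Assignment) := by
        refine integral_mono_ae (integrable_likelihood_mul z hσ hw) (hw.integrable.const_mul C) ?_
        filter_upwards [ae_mem_stdSimplex N.Assignment] with π hπ
        exact mul_le_mul_of_nonneg_right (hC π hπ) (hc.trans (hcw π hπ)).le
    _ = C := by rw [integral_const_mul, hw.integral_eq_one, mul_one]

/-- Up to a constant that does not depend on the data, the marginal likelihood is at least
`c ^ n` times the likelihood of any single local theory. -/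
theorem exists_mul_prod_le_marginalLocal (hσ : σ ∈ N.settingSimplex)
    (hw : IsRegularPriorDensity w) {π₀ : N.Assignment → ℝ} (hπ₀ : π₀ ∈ N.localTheories) {c : ℝ}
    (hc0 : 0 < c) (hc1 : c < 1) :
    ∃ V > 0, ∀ (n : ℕ) (z : Fin n → N.Trial),
      V * ∏ i, (c * N.localDist σ π₀ (z i)) ≤ N.marginalLocal σ w z := by
  obtain ⟨b, hb, hbw⟩ := hw.bounded_away
  have := hw.isFiniteMeasure
  set U := simplexAbove c π₀
  have hU : MeasurableSet U := measurableSet_simplexAbove c π₀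
  refine ⟨b * (simplexVolume N.Assignment).real U, mul_pos hb (ENNReal.toReal_pos
    (simplexVolume_simplexAbove_pos hw.simplexVolume_ne_zero hc0.le hc1 hπ₀).ne'
    (measure_ne_top _ _)), fun n z => ?_⟩
  have hint := integrable_likelihood_mul z hσ hw
  have hL : 0 ≤ ∏ i, (c * N.localDist σ π₀ (z i)) :=
    Finset.prod_nonneg fun i _ => mul_nonneg hc0.le (localDist_nonneg hσ hπ₀ _)
  calc b * (simplexVolume N.Assignment).real U * ∏ i, (c * N.localDist σ π₀ (z i))
      = ∫ _ in U, (∏ i, (c * N.localDist σ π₀ (z i))) * b ∂(simplexVolume N.Assignment) := by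
        rw [setIntegral_const, smul_eq_mul]; ring
    _ ≤ ∫ π in U, (∏ i, N.localDist σ π (z i)) * w π ∂(simplexVolume N.Assignment) := by
        refine setIntegral_mono_on (integrable_const _) hint.integrableOn hU fun π hπ => ?_
        refine mul_le_mul (Finset.prod_le_prod (fun i _ => ?_) fun i _ => ?_)
          (hbw π hπ.1).le hb.le (Finset.prod_nonneg fun i _ => localDist_nonneg hσ hπ.1 _)
        · exact mul_nonneg hc0.le (localDist_nonneg hσ hπ₀ _)
        · exact mul_localDist_le hσ hπ.2 _
    _ ≤ N.marginalLocal σ w z := by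
        refine setIntegral_le_integral hint ?_
        filter_upwards [ae_mem_stdSimplex N.Assignment] with π hπ
        exact mul_nonneg (Finset.prod_nonneg fun i _ => localDist_nonneg hσ hπ _)
          (hb.trans (hbw π hπ)).le

end NonlocalityProof

/-! ### Growth rate of the posterior odds -/

namespace NonlocalityProof

variable {N : NonlocalityProof} {σ : N.Setting → ℝ}

theorem logb_postOdds {w : (N.Assignment → ℝ) → ℝ} {p : ℝ} (hp0 : 0 < p) (hp1 : p < 1) {n : ℕ}
    {z : Fin n → N.Trial} (hQ : 0 < N.marginalQuantum σ z) (hL : 0 < N.marginalLocal σ w z) :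
    Real.logb 2 (N.postOdds σ w p z) =
      Real.logb 2 (p / (1 - p)) + Real.logb 2 (N.marginalQuantum σ z) -
        Real.logb 2 (N.marginalLocal σ w z) := by
  have hp : 0 < 1 - p := sub_pos.2 hp1
  have hsum : 0 < N.marginalQuantum σ z * p + N.marginalLocal σ w z * (1 - p) := by positivity
  have h : N.postOdds σ w p z =
      p / (1 - p) * N.marginalQuantum σ z / N.marginalLocal σ w z := by
    rw [postOdds, posteriorQuantum, posteriorLocal]
    field_simp
  rw [h, Real.logb_div (by positivity) hL.ne', Real.logb_mul (by positivity) hQ.ne']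

/-- The infimum of the divergences is a real number `D`, and it can be computed over the local
theories that are positive on the support of the quantum distribution. -/
theorem exists_coe_eq_iInf_klDivTwo (hσ : σ ∈ N.settingSimplex) :
    ∃ D : ℝ, (⨅ π ∈ N.localTheories, klDivTwo (N.quantumDist σ) (N.localDist σ π)) = (D : EReal) ∧
      (∀ π ∈ N.localTheories, (∀ a, N.quantumDist σ a ≠ 0 → N.localDist σ π a ≠ 0) →
        D ≤ ∑ a, N.quantumDist σ a * Real.logb 2 (N.quantumDist σ a) -
          ∑ a, N.quantumDist σ a * Real.logb 2 (N.localDist σ π a)) ∧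
      ∀ b, D < b → ∃ π ∈ N.localTheories,
        (∀ a, N.quantumDist σ a ≠ 0 → N.localDist σ π a ≠ 0) ∧
        ∑ a, N.quantumDist σ a * Real.logb 2 (N.quantumDist σ a) -
          ∑ a, N.quantumDist σ a * Real.logb 2 (N.localDist σ π a) < b := by
  set I := ⨅ π ∈ N.localTheories, klDivTwo (N.quantumDist σ) (N.localDist σ π)
  have htop : I ≠ ⊤ := by
    obtain ⟨π, hπ, hpos⟩ := exists_localCond_pos hσ
    refine ne_top_of_le_ne_top ?_ (iInf₂_le π hπ)
    have hsupp : ∀ a, N.quantumDist σ a ≠ 0 → N.localDist σ π a ≠ 0 := fun a ha =>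
      mul_ne_zero (left_ne_zero_of_mul ha) (hpos _ _).ne'
    rw [klDivTwo_eq_coe hsupp]
    exact EReal.coe_ne_top _
  have hbot : I ≠ ⊥ := by
    -- Probabilities are at most `1`, so every divergence is at least `∑ q * logb 2 q`.
    refine ne_bot_of_le_ne_bot (EReal.coe_ne_bot
      (∑ a, N.quantumDist σ a * Real.logb 2 (N.quantumDist σ a))) (le_iInf₂ fun π hπ => ?_)
    by_cases hsupp : ∀ a, N.quantumDist σ a ≠ 0 → N.localDist σ π a ≠ 0
    · rw [klDivTwo_eq_coe hsupp, EReal.coe_le_coe_iff, le_sub_self_iff]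
      exact Finset.sum_nonpos fun a _ => mul_nonpos_of_nonneg_of_nonpos (quantumDist_nonneg hσ a)
        (Real.logb_nonpos one_lt_two (localDist_nonneg hσ hπ a) (localDist_le_one hσ hπ a))
    · push Not at hsupp
      obtain ⟨a, ha, h0⟩ := hsupp
      rw [klDivTwo_eq_top ha h0]
      exact le_top
  refine ⟨I.toReal, (EReal.coe_toReal htop hbot).symm, fun π hπ hsupp => ?_, fun b hb => ?_⟩
  · rw [← EReal.coe_le_coe_iff, EReal.coe_toReal htop hbot, ← klDivTwo_eq_coe hsupp]
    exact iInf₂_le π hπ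
  · rw [← EReal.coe_lt_coe_iff, EReal.coe_toReal htop hbot] at hb
    obtain ⟨π, hπ⟩ := iInf_lt_iff.1 hb
    obtain ⟨hmem, hlt⟩ := iInf_lt_iff.1 hπ
    have hsupp : ∀ a, N.quantumDist σ a ≠ 0 → N.localDist σ π a ≠ 0 := fun a ha h0 =>
      not_top_lt (klDivTwo_eq_top ha h0 ▸ hlt)
    refine ⟨π, hmem, hsupp, ?_⟩
    rwa [klDivTwo_eq_coe hsupp, EReal.coe_lt_coe_iff] at hlt

variable {w : (N.Assignment → ℝ) → ℝ} {z : ℕ → N.Trial}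

theorem marginalQuantum_pos (hσ : σ ∈ N.settingSimplex) (hsupp : ∀ i, N.quantumDist σ (z i) ≠ 0)
    (n : ℕ) : 0 < N.marginalQuantum σ fun i : Fin n => z i :=
  Finset.prod_pos fun i _ => (quantumDist_nonneg hσ _).lt_of_ne' (hsupp i)

theorem logb_marginalQuantum (hsupp : ∀ i, N.quantumDist σ (z i) ≠ 0) (n : ℕ) :
    Real.logb 2 (N.marginalQuantum σ fun i : Fin n => z i) =
      n * ∑ a, empiricalFreq z n a * Real.logb 2 (N.quantumDist σ a) := by
  rw [marginalQuantum, ← Finset.prod_range fun i => N.quantumDist σ (z i)]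
  exact logb_prod_range_eq_mul_sum_empiricalFreq fun i _ => hsupp i

theorem marginalLocal_pos (hσ : σ ∈ N.settingSimplex) (hw : IsRegularPriorDensity w)
    (hsupp : ∀ i, N.quantumDist σ (z i) ≠ 0) (n : ℕ) :
    0 < N.marginalLocal σ w fun i : Fin n => z i := by
  obtain ⟨π, hπ, hpos⟩ := exists_localCond_pos hσ
  obtain ⟨V, hV, hle⟩ := exists_mul_prod_le_marginalLocal hσ hw hπ (c := 1 / 2) (by norm_num)
    (by norm_num)
  refine lt_of_lt_of_le ?_ (hle n fun i => z i)
  refine mul_pos hV (Finset.prod_pos fun i _ => mul_pos (by norm_num) (mul_pos ?_ (hpos _ _)))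
  exact (hσ.1 _).lt_of_ne' (left_ne_zero_of_mul (hsupp i))

/-- Asymptotic upper bound on the marginal likelihood of local realism. -/
theorem eventually_logb_marginalLocal_le (hσ : σ ∈ N.settingSimplex)
    (hw : IsRegularPriorDensity w) (hsupp : ∀ i, N.quantumDist σ (z i) ≠ 0)
    (hfreq : ∀ a, Tendsto (fun n => empiricalFreq z n a) atTop (𝓝 (N.quantumDist σ a)))
    {L t : ℝ} (ht0 : 0 < t) (ht1 : t < 1)
    (hL : ∀ π ∈ N.localTheories, (∀ a, N.quantumDist σ a ≠ 0 → N.localDist σ π a ≠ 0) →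
      ∑ a, N.quantumDist σ a * Real.logb 2 (N.localDist σ π a) ≤ L) :
    ∀ᶠ n : ℕ in atTop,
      Real.logb 2 (N.marginalLocal σ w fun i : Fin n => z i) ≤ n * (t * L) := by
  have hev : ∀ᶠ n in atTop, ∀ a, t * N.quantumDist σ a ≤ empiricalFreq z n a := by
    refine eventually_all.2 fun a => ?_
    rcases (quantumDist_nonneg hσ a).eq_or_lt with h0 | hpos
    · refine Eventually.of_forall fun n => ?_
      rw [← h0, mul_zero]
      exact empiricalFreq_nonneg z n a
    · exact (hfreq a).eventually_const_le (mul_lt_of_lt_one_left hpos ht1)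
  filter_upwards [hev] with n hn
  rw [Real.logb_le_iff_le_rpow one_lt_two (marginalLocal_pos hσ hw hsupp n)]
  refine marginalLocal_le _ hσ hw fun π hπ => ?_
  rw [← Finset.prod_range fun i => N.localDist σ π (z i)]
  exact prod_range_le_rpow ht0 (quantumDist_nonneg hσ) hn (localDist_nonneg hσ hπ)
    (localDist_le_one hσ hπ) (hL π hπ)

/-- Lower bound on the marginal likelihood of local realism by the likelihood of a single local
theory, up to a constant and an arbitrarily small exponential rate. -/
theorem exists_le_logb_marginalLocal (hσ : σ ∈ N.settingSimplex)
    (hw : IsRegularPriorDensity w) (hsupp : ∀ i, N.quantumDist σ (z i) ≠ 0)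
    {π : N.Assignment → ℝ} (hπ : π ∈ N.localTheories)
    (hne : ∀ a, N.quantumDist σ a ≠ 0 → N.localDist σ π a ≠ 0) {ε : ℝ} (hε : 0 < ε) :
    ∃ C : ℝ, ∀ n : ℕ,
      C + n * (∑ a, empiricalFreq z n a * Real.logb 2 (N.localDist σ π a) - ε) ≤
        Real.logb 2 (N.marginalLocal σ w fun i : Fin n => z i) := by
  have hc0 : (0 : ℝ) < 2 ^ (-ε) := by positivity
  obtain ⟨V, hV, hle⟩ := exists_mul_prod_le_marginalLocal hσ hw hπ hc0
    (Real.rpow_lt_one_of_one_lt_of_neg one_lt_two (neg_lt_zero.2 hε))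
  refine ⟨Real.logb 2 V, fun n => ?_⟩
  have hpos : ∀ i, 0 < N.localDist σ π (z i) := fun i =>
    (localDist_nonneg hσ hπ _).lt_of_ne' (hne _ (hsupp i))
  have hprod : 0 < ∏ i ∈ Finset.range n, N.localDist σ π (z i) :=
    Finset.prod_pos fun i _ => hpos i
  have h := hle n fun i => z i
  rw [Finset.prod_mul_distrib, Finset.prod_const, Finset.card_univ, Fintype.card_fin,
    ← Finset.prod_range fun i => N.localDist σ π (z i)] at h
  refine le_trans (le_of_eq ?_) (Real.logb_le_logb_of_le one_lt_two (by positivity) h)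
  rw [Real.logb_mul hV.ne' (by positivity), Real.logb_mul (by positivity) hprod.ne',
    Real.logb_pow, Real.logb_rpow two_pos (by norm_num),
    logb_prod_range_eq_mul_sum_empiricalFreq fun i _ => (hpos i).ne']
  ring

/-- The limit of the normalized posterior odds along any sequence of trials in the support of the
quantum distribution whose empirical frequencies converge to that distribution. -/
theorem tendsto_logb_postOdds {p : ℝ} (hp0 : 0 < p) (hp1 : p < 1) (hσ : σ ∈ N.settingSimplex)
    (hw : IsRegularPriorDensity w) (hsupp : ∀ i, N.quantumDist σ (z i) ≠ 0)
    (hfreq : ∀ a, Tendsto (fun n => empiricalFreq z n a) atTop (𝓝 (N.quantumDist σ a))) :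
    Tendsto (fun n : ℕ =>
        ((1 / (n : ℝ) * Real.logb 2 (N.postOdds σ w p fun i : Fin n => z i) : ℝ) : EReal))
      atTop (𝓝 (⨅ π ∈ N.localTheories, klDivTwo (N.quantumDist σ) (N.localDist σ π))) := by
  obtain ⟨D, hD, hlow, happrox⟩ := exists_coe_eq_iInf_klDivTwo hσ
  rw [hD, EReal.tendsto_coe]
  set S := ∑ a, N.quantumDist σ a * Real.logb 2 (N.quantumDist σ a)
  have hodds : ∀ n, Real.logb 2 (N.postOdds σ w p fun i : Fin n => z i) =
      Real.logb 2 (p / (1 - p)) +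
        n * ∑ a, empiricalFreq z n a * Real.logb 2 (N.quantumDist σ a) -
        Real.logb 2 (N.marginalLocal σ w fun i : Fin n => z i) := fun n => by
    rw [logb_postOdds hp0 hp1 (marginalQuantum_pos hσ hsupp n) (marginalLocal_pos hσ hw hsupp n),
      logb_marginalQuantum hsupp]
  have hmean : ∀ g : N.Trial → ℝ, Tendsto (fun n => ∑ a, empiricalFreq z n a * g a) atTop
      (𝓝 (∑ a, N.quantumDist σ a * g a)) := fun g =>
    tendsto_finsetSum _ fun a _ => (hfreq a).mul_const (g a)
  have hconst : ∀ C : ℝ, Tendsto (fun n : ℕ => C / (n : ℝ)) atTop (𝓝 0) := fun C =>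
    tendsto_const_div_atTop_nhds_zero_nat C
  refine tendsto_order.2 ⟨fun b hb => ?_, fun b hb => ?_⟩
  · obtain ⟨t, ht0, ht1, ht⟩ : ∃ t : ℝ, 0 < t ∧ t < 1 ∧ b < S - t * (S - D) := by
      have hcont : Tendsto (fun t : ℝ => S - t * (S - D)) (𝓝[<] 1) (𝓝 (S - 1 * (S - D))) :=
        (Continuous.tendsto (by fun_prop) 1).mono_left nhdsWithin_le_nhds
      have hev := hcont.eventually_const_lt (show b < S - 1 * (S - D) by linarith)
      obtain ⟨t, hbt, ht⟩ := (hev.and (Ioo_mem_nhdsLT (zero_lt_one' ℝ))).exists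
      exact ⟨t, ht.1, ht.2, hbt⟩
    have hlim := ((hconst (Real.logb 2 (p / (1 - p)))).add
      (hmean fun a => Real.logb 2 (N.quantumDist σ a))).sub_const (t * (S - D))
    rw [zero_add] at hlim
    filter_upwards [hlim.eventually_const_lt ht, eventually_gt_atTop 0,
      eventually_logb_marginalLocal_le hσ hw hsupp hfreq ht0 ht1
        fun π hπ hne => le_sub_comm.1 (hlow π hπ hne)] with n h hn hle
    have hn' : (0 : ℝ) < n := by exact_mod_cast hn
    refine h.trans_le ?_
    rw [hodds, one_div, ← div_eq_inv_mul, le_div_iff₀ hn', sub_mul, add_mul,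
      div_mul_cancel₀ _ hn'.ne']
    linarith
  · obtain ⟨π, hπ, hne, hlt⟩ := happrox b hb
    obtain ⟨ε, hε, hεb⟩ : ∃ ε > 0,
        S - (∑ a, N.quantumDist σ a * Real.logb 2 (N.localDist σ π a) - ε) < b := by
      obtain ⟨ε, hε, h⟩ := exists_between (sub_pos.2 hlt)
      exact ⟨ε, hε, by linarith⟩
    obtain ⟨C, hC⟩ := exists_le_logb_marginalLocal hσ hw hsupp hπ hne hε
    have hlim := ((hconst (Real.logb 2 (p / (1 - p)) - C)).add
      (hmean fun a => Real.logb 2 (N.quantumDist σ a))).sub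
      ((hmean fun a => Real.logb 2 (N.localDist σ π a)).sub_const ε)
    rw [zero_add] at hlim
    filter_upwards [hlim.eventually_lt_const hεb, eventually_gt_atTop 0] with n h hn
    have hn' : (0 : ℝ) < n := by exact_mod_cast hn
    refine lt_of_le_of_lt ?_ h
    rw [hodds, one_div, ← div_eq_inv_mul, div_le_iff₀ hn', sub_mul, add_mul,
      div_mul_cancel₀ _ hn'.ne']
    linarith [hC n]

end NonlocalityProof

theorem mainTheorem5 (N : NonlocalityProof) (σ : N.Setting → ℝ) (hσ : σ ∈ N.settingSimplex)
    (w : (N.Assignment → ℝ) → ℝ) (hw : IsRegularPriorDensity w)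
    (p : ℝ) (hp0 : 0 < p) (hp1 : p < 1)
    {Ω : Type*} [MeasurableSpace Ω] (μ : Measure Ω) [IsProbabilityMeasure μ]
    (Z : ℕ → Ω → N.Trial) (hZ : ∀ i, Measurable (Z i)) (hindep : iIndepFun Z μ)
    (hlaw : ∀ i z, μ.real (Z i ⁻¹' {z}) = N.quantumDist σ z) :
    ∀ᵐ ω ∂μ, Tendsto
      (fun n : ℕ =>
        ((1 / (n : ℝ) * Real.logb 2 (N.postOdds σ w p (fun i : Fin n => Z i ω)) : ℝ) : EReal))
      atTop (𝓝 (⨅ π ∈ N.localTheories, klDivTwo (N.quantumDist σ) (N.localDist σ π))) := by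
  have h₁ := ae_tendsto_empiricalFreq (q := N.quantumDist σ) hZ hindep hlaw
  have h₂ := ae_forall_law_ne_zero (q := N.quantumDist σ) hlaw
  filter_upwards [h₁, h₂] with ω hfreq hsupp
  exact NonlocalityProof.tendsto_logb_postOdds (z := fun i => Z i ω) hp0 hp1 hσ hw hsupp hfreq
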